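/- Let $X=\{0,1\}$ and let $\operatorname{Aut}X^*$ be the automorphism group of the binary rooted tree $X^*$, acting on the right. For $g\in\operatorname{Aut}X^*$ and a vertex $v$, let $g|_v$ be the state of $g$ at $v$, defined by $(vw)^g=v^g\,w^{(g|_v)}$ for all words $w$. Let $a$ be the automorphism that exchanges the two maximal subtrees, and define $b,c,d$ recursively by $b=(c,a)$, $c=(a,d)$, $d=(1,b)$, where $g=(g_0,g_1)$ means that $g$ fixes the first level and $g|_x=g_x$ for $x\in X$. Let $G=\langle a,b,c,d\rangle$, let $K$ be the normal closure in $G$ of $\{[a,b],[b,c],[b,d],[c,d],bcd\}$, and let $C$ be the subgroup of $G$ generated by $[K,G]$ and $[a,b][b,c]$. Let $N=\{1,a,b,c,d\}$; for every $g\in G$ all states $g|_w$ with $w$ long enough lie in $N$. Let $\tau$ be the permutation $b\mapsto c\mapsto d\mapsto b$. For $\xi\in\{b,c,d\}$ define $[\xi]:G\to\mathbb F_2$ recursively by $[\xi](g)=1$ if $g=\xi$, $[\xi](g)=0$ if $g\in N\setminus\{\xi\}$, and $[\xi](g)=\sum_{x\in X}[\xi^\tau](g|_x)$ otherwise. Put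 $[x\xi](g)=[\xi](g|_x)$ for $x\in X$, and let $[\varnothing](g)\in\mathbb F_2$ be $0$ if $g$ fixes the first level of the tree and $1$ otherwise. Write $\bar x=1-x$, and let $f_1,f_2,f_3:G\to\mathbb F_2$ be the functions that vanish on $N$ and satisfy, for all $g\in G$, \begin{align*} f_1(g)&=[0d](g)+[1c](g)+[0d](g)[1d](g)+\sum_{x\in X}\bigl([xb](g)[\bar xd](g)+f_2(g|_x)\bigr),\\ f_2(g)&=[0b](g)+[1c](g)+[0c](g)[1c](g)+\sum_{x\in X}f_3(g|_x),\\ f_3(g)&=[0d](g)+[1c](g)+[0c](g)[1c](g)+\sum_{x\in X}\bigl([xb](g)[\bar xc](g)+[xb](g)[\bar xd](g)+f_1(g|_x)\bigr). \end{align*} Let $\Gamma$ be the group with presentation \[\Gamma=\langle a,b,c,d\mid a^2,b^2,c^2,d^2,[a,b]^2,[a,c]^2,\ [a,b]=[b,c]=[c,d]=[d,b],\ [a,d]=[a,b][a,c]\rangle .\] Then $\Gamma$ is nilpotent of order $2^6$, and the map $\pi:G\to\Gamma$ defined by \[\pi(g)=a^{[\varnothing](g)}\,b^{[b](g)}\,c^{[c](g)}\,d^{[d](g)}\,[a,b]^{e(g)}\,[a,c]^{f(g)},\]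 where \[e=f_3+[\varnothing]\cdot([b]+[d])+[0b]+[0d],\qquad f=[\varnothing]\cdot([c]+[d])+[0b]+[0d],\] is a surjective group homomorphism with kernel $C$. -/

import Mathlib

namespace TwistedTwin

/-! ### The binary rooted tree and its automorphisms

The alphabet `X = {0, 1}` is `Bool` (`0 = false`, `1 = true`), the vertices of the tree are the finite
words `List Bool`, and a rooted tree automorphism is a bijection of the words that preserves the
prefix relation in both directions. -/

/-- The automorphism group of the binary rooted tree. It acts on the *right*: the product `g * h`
means first `g`, then `h` (hence the opposite of the group of relation isomorphisms, whose
product is composition of maps). -/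
abbrev TreeAut : Type :=
  (RelIso (fun v w : List Bool => v <+: w) (fun v w : List Bool => v <+: w))ᵐᵒᵖ

/-- The image `v ^ g` of the vertex `v` under the automorphism `g`. -/
def img (g : TreeAut) (v : List Bool) : List Bool := g.unop v

theorem img_mul (g h : TreeAut) (v : List Bool) : img (g * h) v = img h (img g v) := rfl

theorem img_one (v : List Bool) : img 1 v = v := rfl

theorem img_inv_img (g : TreeAut) (v : List Bool) : img g⁻¹ (img g v) = v := by
  rw [← img_mul, mul_inv_cancel, img_one]

theorem img_img_inv (g : TreeAut) (v : List Bool) : img g (img g⁻¹ v) = v := by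
  rw [← img_mul, inv_mul_cancel, img_one]

theorem img_prefix (g : TreeAut) (v w : List Bool) : img g v <+: img g w ↔ v <+: w :=
  g.unop.map_rel_iff

theorem img_injective (g : TreeAut) : Function.Injective (img g) := g.unop.injective

theorem treeAut_ext {g h : TreeAut} (H : ∀ v, img g v = img h v) : g = h :=
  MulOpposite.unop_injective (RelIso.ext H)

theorem length_le_img (g : TreeAut) (v : List Bool) : v.length ≤ (img g v).length := by
  induction v using List.reverseRecOn with
  | nil => simp
  | append_singleton v x ih =>
    have h1 : img g v <+: img g (v ++ [x]) := (img_prefix g _ _).2 (List.prefix_append v [x])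
    have h2 : (img g v).length ≠ (img g (v ++ [x])).length := by
      intro h
      have := congrArg List.length (img_injective g (h1.eq_of_length h))
      simp at this
    have h3 := h1.length_le
    simp only [List.length_append, List.length_singleton]
    omega

theorem length_img (g : TreeAut) (v : List Bool) : (img g v).length = v.length := by
  have h1 := length_le_img g v
  have h2 := length_le_img g⁻¹ (img g v)
  rw [img_inv_img] at h2
  omega

/-- The part of `(v w) ^ g` below level `|v|`. -/
def below (g : TreeAut) (v w : List Bool) : List Bool := (img g (v ++ w)).drop v.length

theorem img_append (g : TreeAut) (v w : List Bool) : img g (v ++ w) = img g v ++ below g v w := by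
  obtain ⟨t, ht⟩ := (img_prefix g v (v ++ w)).2 (List.prefix_append v w)
  rw [below, ← ht, ← length_img g v, List.drop_left]

theorem below_inv (g : TreeAut) (v w : List Bool) : below g⁻¹ (img g v) (below g v w) = w := by
  have h := img_append g⁻¹ (img g v) (below g v w)
  rw [← img_append, img_inv_img, img_inv_img] at h
  exact (List.append_cancel_left h).symm

/-- The state `g|_v` of `g` at the vertex `v`, characterized by
`(v w) ^ g = v ^ g  w ^ (g|_v)` for all words `w`. -/
def state (g : TreeAut) (v : List Bool) : TreeAut :=
  MulOpposite.op
    { toFun := below g v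
      invFun := below g⁻¹ (img g v)
      left_inv := below_inv g v
      right_inv := fun w => by
        have h := below_inv g⁻¹ (img g v) w
        rwa [img_inv_img, inv_inv] at h
      map_rel_iff' := by
        intro w₁ w₂
        have h := img_prefix g (v ++ w₁) (v ++ w₂)
        rw [img_append, img_append, List.prefix_append_right_inj,
          List.prefix_append_right_inj] at h
        exact h }

theorem img_state (g : TreeAut) (v w : List Bool) : img g (v ++ w) = img g v ++ img (state g v) w :=
  img_append g v w

theorem state_unique {g h : TreeAut} {v : List Bool}
    (H : ∀ w, img g (v ++ w) = img g v ++ img h w) : state g v = h := by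
  apply treeAut_ext
  intro w
  have h1 := H w
  rw [img_state] at h1
  exact List.append_cancel_left h1

theorem state_append (g : TreeAut) (v w : List Bool) : state g (v ++ w) = state (state g v) w := by
  apply state_unique
  intro u
  rw [List.append_assoc, img_state, img_state, img_state g v w, List.append_assoc]

theorem state_mul (g h : TreeAut) (v : List Bool) :
    state (g * h) v = state g v * state h (img g v) := by
  apply state_unique
  intro u
  rw [img_mul, img_mul, img_state, img_state, img_mul]

theorem state_one (v : List Bool) : state 1 v = 1 := by
  apply state_unique
  intro u
  rfl

theorem state_inv (g : TreeAut) (v : List Bool) : state g⁻¹ v = (state g (img g⁻¹ v))⁻¹ := by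
  rw [eq_inv_iff_mul_eq_one, ← state_mul, inv_mul_cancel, state_one]

theorem state_nil (g : TreeAut) : state g [] = g := by
  apply state_unique
  intro u
  have : img g [] = [] := List.length_eq_zero_iff.1 (length_img g [])
  rw [this]
  rfl

theorem state_cons (g : TreeAut) (x : Bool) (w : List Bool) :
    state g (x :: w) = state (state g [x]) w := state_append g [x] w

/-! ### The group `G` -/

/-- The five states of the automaton that defines the group. -/
inductive Q
  | e | a | b | c | d
  deriving DecidableEq

/-- The transitions of the automaton: `a = σ`, `b = (c, a)`, `c = (a, d)`, `d = (1, b)`. -/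
def Q.next : Q → Bool → Q
  | .e, _ => .e
  | .a, _ => .e
  | .b, false => .c
  | .b, true => .a
  | .c, false => .a
  | .c, true => .d
  | .d, false => .e
  | .d, true => .b

/-- Only the state `a` exchanges the two letters. -/
def Q.out : Q → Bool → Bool
  | .a, x => !x
  | _, x => x

/-- The action of the automaton on words. -/
def Q.run : Q → List Bool → List Bool
  | _, [] => []
  | s, x :: w => s.out x :: (s.next x).run w

theorem Q.run_run (s : Q) (w : List Bool) : s.run (s.run w) = w := by
  induction w generalizing s with
  | nil => rfl
  | cons x w ih => cases s <;> cases x <;> simp [Q.run, Q.out, Q.next, ih]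

theorem Q.run_prefix (s : Q) (v w : List Bool) : s.run v <+: s.run w ↔ v <+: w := by
  induction v generalizing s w with
  | nil => simp [Q.run]
  | cons x v ih =>
    cases w with
    | nil => simp [Q.run]
    | cons y w => cases s <;> cases x <;> cases y <;> simp [Q.run, Q.out, Q.next, ih]

/-- The tree automorphism defined by a state of the automaton. -/
def Q.aut (s : Q) : TreeAut :=
  MulOpposite.op
    { toFun := s.run
      invFun := s.run
      left_inv := s.run_run
      right_inv := s.run_run
      map_rel_iff' := fun {v w} => s.run_prefix v w }

theorem Q.img_aut (s : Q) (w : List Bool) : img s.aut w = s.run w := rfl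

theorem Q.aut_e : Q.aut .e = 1 := by
  apply treeAut_ext
  intro w
  rw [Q.img_aut, img_one]
  induction w with
  | nil => rfl
  | cons x w ih => simp [Q.run, Q.out, Q.next, ih]

theorem Q.aut_mul_self (s : Q) : s.aut * s.aut = 1 := treeAut_ext s.run_run

/-- The wreath recursion `a = σ`, `b = (c, a)`, `c = (a, d)`, `d = (1, b)`. -/
theorem Q.state_aut (s : Q) (x : Bool) : state s.aut [x] = (s.next x).aut :=
  state_unique fun _ => rfl

/-- The generators `a`, `b`, `c`, `d` as tree automorphisms. -/
def tA : TreeAut := Q.aut .a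
def tB : TreeAut := Q.aut .b
def tC : TreeAut := Q.aut .c
def tD : TreeAut := Q.aut .d

/-- The twisted twin `G` of the Grigorchuk group. -/
def G : Subgroup TreeAut := Subgroup.closure {tA, tB, tC, tD}

/-- The generators `a`, `b`, `c`, `d` as elements of `G`. -/
def gA : G := ⟨tA, Subgroup.subset_closure (by simp)⟩
def gB : G := ⟨tB, Subgroup.subset_closure (by simp)⟩
def gC : G := ⟨tC, Subgroup.subset_closure (by simp)⟩
def gD : G := ⟨tD, Subgroup.subset_closure (by simp)⟩

/-- The commutator `[x, y] = x⁻¹ y⁻¹ x y`. -/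
def comm {H : Type*} [Group H] (x y : H) : H := x⁻¹ * y⁻¹ * x * y

/-- `K` is the normal closure in `G` of `[a,b], [b,c], [b,d], [c,d], bcd`. -/
def K : Subgroup G :=
  Subgroup.normalClosure {comm gA gB, comm gB gC, comm gB gD, comm gC gD, gB * gC * gD}

/-- `C` is the subgroup of `G` generated by `[K, G]` and `[a,b][b,c]`. -/
def C : Subgroup G :=
  ⁅K, (⊤ : Subgroup G)⁆ ⊔ Subgroup.closure {comm gA gB * comm gB gC}

/-! ### The nucleus and contraction -/

/-- The set `N = {1, a, b, c, d}`. -/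
def N : Set TreeAut := {1, tA, tB, tC, tD}

theorem mem_N_iff (g : TreeAut) : g ∈ N ↔ ∃ s : Q, g = s.aut := by
  constructor
  · rintro (h | h | h | h | h)
    · exact ⟨.e, h.trans Q.aut_e.symm⟩
    · exact ⟨.a, h⟩
    · exact ⟨.b, h⟩
    · exact ⟨.c, h⟩
    · exact ⟨.d, h⟩
  · rintro ⟨s, rfl⟩
    cases s
    · exact Or.inl Q.aut_e
    all_goals simp [N, tA, tB, tC, tD]

/-- All states of `g` at level `n` and below lie in `N`. -/
def InN (n : ℕ) (g : TreeAut) : Prop := ∀ w : List Bool, n ≤ w.length → state g w ∈ N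

theorem InN.mono {m n : ℕ} (h : m ≤ n) {g : TreeAut} (hg : InN m g) : InN n g :=
  fun w hw => hg w (h.trans hw)

theorem InN.step {n : ℕ} {g : TreeAut} (h : ∀ x, InN n (state g [x])) : InN (n + 1) g := by
  intro w hw
  cases w with
  | nil => simp at hw
  | cons x w =>
    rw [state_cons]
    exact h x w (by simpa using hw)

theorem InN.state {n : ℕ} {g : TreeAut} (h : InN (n + 1) g) (x : Bool) :
    InN n (TwistedTwin.state g [x]) := by
  intro w hw
  rw [← state_cons]
  exact h _ (by simpa using hw)

theorem state_mem_N {g : TreeAut} (hg : g ∈ N) (w : List Bool) : state g w ∈ N := by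
  induction w generalizing g with
  | nil => rwa [state_nil]
  | cons x w ih =>
    rw [state_cons]
    obtain ⟨s, rfl⟩ := (mem_N_iff g).1 hg
    exact ih ((mem_N_iff _).2 ⟨_, s.state_aut x⟩)

theorem inN_zero {g : TreeAut} (hg : g ∈ N) : InN 0 g := fun w _ => state_mem_N hg w

theorem state_aut_mul (s t : Q) (x : Bool) :
    state (s.aut * t.aut) [x] = (s.next x).aut * (t.next (s.out x)).aut := by
  rw [state_mul, Q.state_aut, Q.img_aut, ← Q.state_aut t]
  rfl

theorem inN_e_left (t : Q) : InN 0 (Q.aut .e * t.aut) := by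
  rw [Q.aut_e, one_mul]
  exact inN_zero ((mem_N_iff _).2 ⟨t, rfl⟩)

theorem inN_e_right (t : Q) : InN 0 (t.aut * Q.aut .e) := by
  rw [Q.aut_e, mul_one]
  exact inN_zero ((mem_N_iff _).2 ⟨t, rfl⟩)

theorem inN_a_left (t : Q) : InN 1 (Q.aut .a * t.aut) :=
  InN.step fun x => by
    rw [state_aut_mul]
    exact inN_e_left _

theorem inN_a_right (t : Q) : InN 1 (t.aut * Q.aut .a) :=
  InN.step fun x => by
    rw [state_aut_mul]
    exact inN_e_right _

theorem inN_self (s : Q) : InN 0 (s.aut * s.aut) := by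
  rw [Q.aut_mul_self]
  exact inN_zero (Or.inl rfl)

theorem inN_mul_aut (s t : Q) : InN 3 (s.aut * t.aut) := by
  have bd : InN 2 (Q.aut .b * Q.aut .d) := InN.step fun x => by
    rw [state_aut_mul]
    cases x
    · exact (inN_e_right _).mono (by norm_num)
    · exact inN_a_left _
  have db : InN 2 (Q.aut .d * Q.aut .b) := InN.step fun x => by
    rw [state_aut_mul]
    cases x
    · exact (inN_e_left _).mono (by norm_num)
    · exact inN_a_right _
  have bc : InN 2 (Q.aut .b * Q.aut .c) := InN.step fun x => by
    rw [state_aut_mul]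
    cases x
    · exact inN_a_right _
    · exact inN_a_left _
  have cb : InN 2 (Q.aut .c * Q.aut .b) := InN.step fun x => by
    rw [state_aut_mul]
    cases x
    · exact inN_a_left _
    · exact inN_a_right _
  have cd : InN 3 (Q.aut .c * Q.aut .d) := InN.step fun x => by
    rw [state_aut_mul]
    cases x
    · exact (inN_e_right _).mono (by norm_num)
    · exact db
  have dc : InN 3 (Q.aut .d * Q.aut .c) := InN.step fun x => by
    rw [state_aut_mul]
    cases x
    · exact (inN_e_left _).mono (by norm_num)
    · exact bd
  cases s with
  | e => exact (inN_e_left t).mono (Nat.zero_le 3)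
  | a => exact (inN_a_left t).mono (by norm_num)
  | b =>
    cases t with
    | e => exact (inN_e_right .b).mono (Nat.zero_le 3)
    | a => exact (inN_a_right .b).mono (by norm_num)
    | b => exact (inN_self .b).mono (Nat.zero_le 3)
    | c => exact bc.mono (by norm_num)
    | d => exact bd.mono (by norm_num)
  | c =>
    cases t with
    | e => exact (inN_e_right .c).mono (Nat.zero_le 3)
    | a => exact (inN_a_right .c).mono (by norm_num)
    | b => exact cb.mono (by norm_num)
    | c => exact (inN_self .c).mono (Nat.zero_le 3)
    | d => exact cd
  | d =>
    cases t with
    | e => exact (inN_e_right .d).mono (Nat.zero_le 3)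
    | a => exact (inN_a_right .d).mono (by norm_num)
    | b => exact db.mono (by norm_num)
    | c => exact dc
    | d => exact (inN_self .d).mono (Nat.zero_le 3)

/-- `G` is contracting. -/
theorem contracting {g : TreeAut} (hg : g ∈ G) : ∃ n, InN n g := by
  induction hg using Subgroup.closure_induction with
  | mem g hg => exact ⟨0, inN_zero (Or.inr hg)⟩
  | one => exact ⟨0, inN_zero (Or.inl rfl)⟩
  | mul g h _ _ ihg ihh =>
    obtain ⟨m, hm⟩ := ihg
    obtain ⟨n, hn⟩ := ihh
    refine ⟨max m n + 3, fun w hw => ?_⟩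
    have hlen : (w.take (max m n)).length = max m n := by
      rw [List.length_take]; omega
    rw [← List.take_append_drop (max m n) w, state_append, state_mul]
    obtain ⟨s, hs⟩ := (mem_N_iff _).1 (hm (w.take (max m n)) (by rw [hlen]; exact le_max_left _ _))
    obtain ⟨t, ht⟩ := (mem_N_iff _).1 (hn (img g (w.take (max m n)))
      (by rw [length_img, hlen]; exact le_max_right _ _))
    rw [hs, ht]
    exact inN_mul_aut s t _ (by rw [List.length_drop]; omega)
  | inv g _ ih =>
    obtain ⟨n, hn⟩ := ih
    refine ⟨n, fun w hw => ?_⟩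
    obtain ⟨s, hs⟩ := (mem_N_iff _).1 (hn (img g⁻¹ w) (by rwa [length_img]))
    rw [state_inv, hs]
    exact (mem_N_iff _).2 ⟨s, inv_eq_of_mul_eq_one_left s.aut_mul_self⟩

/-- The first level from which on all states of `g` lie in `N`. -/
noncomputable def depth (g : TreeAut) : ℕ := sInf {n | InN n g}

theorem inN_depth {g : TreeAut} (hg : g ∈ G) : InN (depth g) g := Nat.sInf_mem (contracting hg)

theorem state_mem_G {g : TreeAut} (hg : g ∈ G) (w : List Bool) : state g w ∈ G := by
  have hN : N ⊆ G := by
    rintro h (rfl | h)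
    · exact one_mem _
    · exact Subgroup.subset_closure h
  induction hg using Subgroup.closure_induction generalizing w with
  | mem g hg => exact hN (state_mem_N (Or.inr hg) w)
  | one => rw [state_one]; exact one_mem _
  | mul g h _ _ ihg ihh => rw [state_mul]; exact mul_mem (ihg _) (ihh _)
  | inv g _ ih => rw [state_inv]; exact inv_mem (ih _)

/-! ### The functions `[ξ]` -/

/-- The symbols `b`, `c`, `d`. -/
inductive Letter
  | b | c | d

/-- The permutation `τ : b ↦ c ↦ d ↦ b`. -/
def Letter.τ : Letter → Letter
  | .b => .c
  | .c => .d
  | .d => .b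

/-- The element of `G` named by a symbol. -/
def Letter.elt : Letter → TreeAut
  | .b => tB
  | .c => tC
  | .d => tD

open Classical in
/-- The recursion for `[ξ]`, carried out down to a given level. -/
noncomputable def countTo : ℕ → Letter → TreeAut → ZMod 2
  | 0, ξ, g => if g = ξ.elt then 1 else 0
  | n + 1, ξ, g =>
    if g = ξ.elt then 1 else if g ∈ N then 0 else ∑ x : Bool, countTo n ξ.τ (state g [x])

/-- The function `[ξ]`. By `count_eq` it satisfies its defining recursion on all of `G`. -/
noncomputable def count (ξ : Letter) (g : TreeAut) : ZMod 2 := countTo (depth g) ξ g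

theorem countTo_succ {n : ℕ} {g : TreeAut} (h : InN n g) (ξ : Letter) :
    countTo (n + 1) ξ g = countTo n ξ g := by
  induction n generalizing g ξ with
  | zero =>
    have hg : g ∈ N := by simpa [state_nil] using h [] le_rfl
    simp [countTo, hg]
  | succ n ih =>
    rw [countTo, countTo]
    simp only [ih (h.state _)]

theorem countTo_eq {n : ℕ} {g : TreeAut} (h : InN n g) (ξ : Letter) :
    countTo n ξ g = count ξ g := by
  have h0 : InN (depth g) g := Nat.sInf_mem (s := {n | InN n g}) ⟨n, h⟩
  have hle : depth g ≤ n := Nat.sInf_le h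
  induction n, hle using Nat.le_induction with
  | base => rfl
  | succ n hle ih => rw [countTo_succ (h0.mono hle), ih (h0.mono hle)]

open Classical in
/-- The defining recursion of `[ξ]`. -/
theorem count_eq {g : TreeAut} (hg : g ∈ G) (ξ : Letter) :
    count ξ g = if g = ξ.elt then 1 else if g ∈ N then 0
      else ∑ x : Bool, count ξ.τ (state g [x]) := by
  have h := (inN_depth hg).mono (Nat.le_succ _)
  rw [← countTo_eq h, countTo]
  simp only [countTo_eq (h.state _)]

/-- `[x ξ](g) = [ξ](g|_x)`. -/
noncomputable def countAt (x : Bool) (ξ : Letter) (g : TreeAut) : ZMod 2 := count ξ (state g [x])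

open Classical in
/-- `[∅]`: equal to `0` on automorphisms that fix the first level and to `1` on the others. -/
noncomputable def sign (g : TreeAut) : ZMod 2 := if img g [false] = [false] then 0 else 1

/-! ### The functions `f₁`, `f₂`, `f₃` -/

/-- The non-recursive part of the definition of `f₁`. -/
noncomputable def q₁ (g : TreeAut) : ZMod 2 :=
  countAt false .d g + countAt true .c g + countAt false .d g * countAt true .d g
    + ∑ x : Bool, countAt x .b g * countAt (!x) .d g

/-- The non-recursive part of the definition of `f₂`. -/
noncomputable def q₂ (g : TreeAut) : ZMod 2 :=
  countAt false .b g + countAt true .c g + countAt false .c g * countAt true .c g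

/-- The non-recursive part of the definition of `f₃`. -/
noncomputable def q₃ (g : TreeAut) : ZMod 2 :=
  countAt false .d g + countAt true .c g + countAt false .c g * countAt true .c g
    + ∑ x : Bool, (countAt x .b g * countAt (!x) .c g + countAt x .b g * countAt (!x) .d g)

mutual
/-- The terms of the recursion for `f₁` above a given level. -/
noncomputable def f₁To : ℕ → TreeAut → ZMod 2
  | 0, _ => 0
  | n + 1, g => q₁ g + ∑ x : Bool, f₂To n (state g [x])
/-- The terms of the recursion for `f₂` above a given level. -/
noncomputable def f₂To : ℕ → TreeAut → ZMod 2
  | 0, _ => 0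
  | n + 1, g => q₂ g + ∑ x : Bool, f₃To n (state g [x])
/-- The terms of the recursion for `f₃` above a given level. -/
noncomputable def f₃To : ℕ → TreeAut → ZMod 2
  | 0, _ => 0
  | n + 1, g => q₃ g + ∑ x : Bool, f₁To n (state g [x])
end

/-- The function `f₁`: all terms of its expansion, those below level `depth g` being zero.
By `f₁_eq` and `f_eq_zero` it satisfies its recursion on `G` and vanishes on `N`; likewise for
`f₂` and `f₃`. -/
noncomputable def f₁ (g : TreeAut) : ZMod 2 := f₁To (depth g) g
noncomputable def f₂ (g : TreeAut) : ZMod 2 := f₂To (depth g) g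
noncomputable def f₃ (g : TreeAut) : ZMod 2 := f₃To (depth g) g

/-- The state of the automaton named by a symbol. -/
def Letter.q : Letter → Q
  | .b => .b
  | .c => .c
  | .d => .d

theorem Q.aut_injective : Function.Injective Q.aut := by
  intro s t h
  have h1 := congrArg (fun g => img g [false]) h
  have h2 := congrArg (fun g => img g [true, false]) h
  have h3 := congrArg (fun g => img g [false, false]) h
  have h4 := congrArg (fun g => img g [true, true, false]) h
  simp only [Q.img_aut] at h1 h2 h3 h4
  revert h1 h2 h3 h4
  cases s <;> cases t <;> decide

theorem count_aut (ξ : Letter) (s : Q) : count ξ s.aut = if s = ξ.q then 1 else 0 := by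
  rw [← countTo_eq (inN_zero ((mem_N_iff _).2 ⟨s, rfl⟩)), countTo]
  have : ξ.elt = ξ.q.aut := by cases ξ <;> rfl
  simp only [this, Q.aut_injective.eq_iff]

theorem q_eq_zero {g : TreeAut} (hg : g ∈ N) : q₁ g = 0 ∧ q₂ g = 0 ∧ q₃ g = 0 := by
  obtain ⟨s, rfl⟩ := (mem_N_iff _).1 hg
  cases s <;>
    simp [q₁, q₂, q₃, countAt, Q.state_aut, count_aut, Q.next, Letter.q]

theorem fTo_eq_zero (n : ℕ) {g : TreeAut} (hg : g ∈ N) :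
    f₁To n g = 0 ∧ f₂To n g = 0 ∧ f₃To n g = 0 := by
  induction n generalizing g with
  | zero => simp [f₁To, f₂To, f₃To]
  | succ n ih =>
    have h := fun x => ih (state_mem_N hg [x])
    simp [f₁To, f₂To, f₃To, q_eq_zero hg, h]

theorem fTo_succ {n : ℕ} {g : TreeAut} (h : InN n g) :
    f₁To (n + 1) g = f₁To n g ∧ f₂To (n + 1) g = f₂To n g ∧ f₃To (n + 1) g = f₃To n g := by
  induction n generalizing g with
  | zero =>
    have hg : g ∈ N := by simpa [state_nil] using h [] le_rfl
    simp only [fTo_eq_zero _ hg, and_self]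
  | succ n ih =>
    have h := fun x => ih (h.state x)
    simp only [f₁To.eq_2 g, f₂To.eq_2 g, f₃To.eq_2 g, h, and_self]

theorem fTo_eq {n : ℕ} {g : TreeAut} (h : InN n g) :
    f₁To n g = f₁ g ∧ f₂To n g = f₂ g ∧ f₃To n g = f₃ g := by
  have h0 : InN (depth g) g := Nat.sInf_mem (s := {n | InN n g}) ⟨n, h⟩
  have hle : depth g ≤ n := Nat.sInf_le h
  induction n, hle using Nat.le_induction with
  | base => exact ⟨rfl, rfl, rfl⟩
  | succ n hle ih =>
    have h1 := fTo_succ (h0.mono hle)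
    rw [h1.1, h1.2.1, h1.2.2]
    exact ih (h0.mono hle)

/-- The functions `f₁`, `f₂`, `f₃` vanish on `N`. -/
theorem f_eq_zero {g : TreeAut} (hg : g ∈ N) : f₁ g = 0 ∧ f₂ g = 0 ∧ f₃ g = 0 :=
  fTo_eq_zero _ hg

/-- The defining recursion of `f₁`. -/
theorem f₁_eq {g : TreeAut} (hg : g ∈ G) :
    f₁ g = countAt false .d g + countAt true .c g + countAt false .d g * countAt true .d g
      + ∑ x : Bool, (countAt x .b g * countAt (!x) .d g + f₂ (state g [x])) := by
  have h := (inN_depth hg).mono (Nat.le_succ _)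
  rw [← (fTo_eq h).1, f₁To, q₁, Finset.sum_add_distrib, ← add_assoc]
  simp only [fun x => (fTo_eq (h.state x)).2.1]

/-- The defining recursion of `f₂`. -/
theorem f₂_eq {g : TreeAut} (hg : g ∈ G) :
    f₂ g = countAt false .b g + countAt true .c g + countAt false .c g * countAt true .c g
      + ∑ x : Bool, f₃ (state g [x]) := by
  have h := (inN_depth hg).mono (Nat.le_succ _)
  rw [← (fTo_eq h).2.1, f₂To, q₂]
  simp only [fun x => (fTo_eq (h.state x)).2.2]

/-- The defining recursion of `f₃`. -/
theorem f₃_eq {g : TreeAut} (hg : g ∈ G) :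
    f₃ g = countAt false .d g + countAt true .c g + countAt false .c g * countAt true .c g
      + ∑ x : Bool, (countAt x .b g * countAt (!x) .c g + countAt x .b g * countAt (!x) .d g
        + f₁ (state g [x])) := by
  have h := (inN_depth hg).mono (Nat.le_succ _)
  rw [← (fTo_eq h).2.2, f₃To, q₃, Finset.sum_add_distrib (g := fun x => f₁ (TwistedTwin.state g [x])), ← add_assoc]
  simp only [fun x => (fTo_eq (h.state x)).1]

/-! ### The group `Γ` and the map `π` -/

/-- The generators of the presentation of `Γ`. -/
inductive Gen
  | a | b | c | d

/-- The relators of `Γ`: those of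
`a², b², c², d², [a,b]², [a,c]², [a,b] = [b,c] = [c,d] = [d,b], [a,d] = [a,b][a,c]`. -/
def rels : Set (FreeGroup Gen) :=
  let a := FreeGroup.of Gen.a
  let b := FreeGroup.of Gen.b
  let c := FreeGroup.of Gen.c
  let d := FreeGroup.of Gen.d
  {a ^ 2, b ^ 2, c ^ 2, d ^ 2, comm a b ^ 2, comm a c ^ 2,
    comm a b * (comm b c)⁻¹, comm b c * (comm c d)⁻¹, comm c d * (comm d b)⁻¹,
    comm a d * (comm a b * comm a c)⁻¹}

/-- The group `Γ`. -/
abbrev Gam : Type := PresentedGroup rels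

/-- The generators of `Γ`. -/
def gam (s : Gen) : Gam := PresentedGroup.of s

/-- The exponent `e = f₃ + [∅]([b] + [d]) + [0b] + [0d]`. -/
noncomputable def expE (g : TreeAut) : ZMod 2 :=
  f₃ g + sign g * (count .b g + count .d g) + countAt false .b g + countAt false .d g

/-- The exponent `f = [∅]([c] + [d]) + [0b] + [0d]`. -/
noncomputable def expF (g : TreeAut) : ZMod 2 :=
  sign g * (count .c g + count .d g) + countAt false .b g + countAt false .d g

/-- The map `π : G → Γ`; an exponent in `ZMod 2` is read as `0` or `1`. -/
noncomputable def piMap (g : G) : Gam :=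
  gam .a ^ (sign g).val * gam .b ^ (count .b g).val * gam .c ^ (count .c g).val
    * gam .d ^ (count .d g).val * comm (gam .a) (gam .b) ^ (expE g).val
    * comm (gam .a) (gam .c) ^ (expF g).val

end TwistedTwin

namespace TwistedTwin

/-! ### The action on the first level -/

-- Both halves of the theorem come from coordinates. In `Γ` the elements `z = [a,b]` and `w = [a,c]`
-- are central involutions, and the relations allow any word to be collected into the form `a^s b^β
-- c^γ d^δ z^ζ w^ω`. Collection adds the exponents and adds to those of `z` and `w` certain bilinear
-- forms in the exponents of the two factors. This law makes the six-dimensional space over `𝔽₂` a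
-- group, `Model`. It satisfies the relations of `Γ`, so no two normal forms coincide and `Γ` has
-- order 64.
--
-- That `π` is a homomorphism now means that its six exponents multiply by this law. For the
-- recursive functions `[ξ]` and `f₁`, `f₂`, `f₃` the reason is contraction: the failure of the
-- expected product formula at `(g, h)` is the sum of the failures at the pairs of states `(g|_x,
-- h|_{x^g})`, and these pairs descend into the nucleus, where repeated descent ends at pairs with
-- no failure (`defect_eq_zero`). This shows that `[ξ]` is additive (`count_mul`) and that `f₁`,
-- `f₂`, `f₃` are additive up to explicit bilinear forms (`fAt_mul`). The correction terms in `e`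
-- and `f` turn those forms into the collection law (`expE_mul`, `expF_mul`).
--
-- For the kernel, `π` sends `K` into the centre and `[a,b][b,c]` to `z² = 1`, so `C` is killed
-- (`C_le_ker`). Conversely, `K` is central modulo `C`, which together with `(ad)⁴ = 1` forces the
-- relations of `Γ` in `G/C` (`gam_relations`). The resulting map `Γ → G/C`, composed with `π`, is
-- the quotient map, so the kernel lies in `C` (`ker_le_C`).

theorem sign_cases (g : TreeAut) :
    (sign g = 0 ∧ img g [false] = [false] ∧ img g [true] = [true]) ∨
      (sign g = 1 ∧ img g [false] = [true] ∧ img g [true] = [false]) := by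
  obtain ⟨x, hx⟩ := List.length_eq_one_iff.1 (length_img g [false])
  obtain ⟨y, hy⟩ := List.length_eq_one_iff.1 (length_img g [true])
  have hne : x ≠ y := by
    rintro rfl
    simpa using img_injective g (hx.trans hy.symm)
  cases x <;> cases y <;> simp_all [sign]

theorem sign_mul (g h : TreeAut) : sign (g * h) = sign g + sign h := by
  have h2 : (1 : ZMod 2) + 1 = 0 := rfl
  rcases sign_cases g with ⟨h1, h1f, h1t⟩ | ⟨h1, h1f, h1t⟩ <;>
  rcases sign_cases h with ⟨h3, h3f, h3t⟩ | ⟨h3, h3f, h3t⟩ <;>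
    simp [h1, h3, h2] <;> simp [sign, img_mul, *]

theorem sign_one : sign 1 = 0 := by simp [sign, img_one]

theorem sign_inv (g : TreeAut) : sign g⁻¹ = sign g := by
  have h := sign_mul g g⁻¹
  rw [mul_inv_cancel, sign_one] at h
  grind

theorem sign_aut (s : Q) : sign s.aut = if s = .a then 1 else 0 := by
  cases s <;> simp [sign, Q.img_aut, Q.run, Q.out]

theorem aut_mem_G (s : Q) : s.aut ∈ G := by
  cases s
  · rw [Q.aut_e]; exact one_mem _
  all_goals exact Subgroup.subset_closure (by simp [tA, tB, tC, tD])

/-! ### Contraction of two-variable defects -/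

/-- A family of functions of two elements of `G` that is passed on to the states, and vanishes
on the pairs `(1, t)`, `(t, 1)`, `(t, t)` with `t` in the nucleus, is zero. -/
theorem defect_eq_zero {ι : Type*} (p : ι → ι) (D : ι → TreeAut → TreeAut → ZMod 2)
    (hrec : ∀ i, ∀ g ∈ G, ∀ h ∈ G, D i g h =
      D (p i) (state g [false]) (state h (img g [false]))
        + D (p i) (state g [true]) (state h (img g [true])))
    (hleft : ∀ i (t : Q), D i 1 t.aut = 0) (hright : ∀ i (t : Q), D i t.aut 1 = 0)
    (hself : ∀ i (t : Q), D i t.aut t.aut = 0)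
    (i : ι) {g h : TreeAut} (hg : g ∈ G) (hh : h ∈ G) : D i g h = 0 := by
  rw [← Q.aut_e] at hleft hright
  have step (i : ι) (s t : Q) : D i s.aut t.aut =
      D (p i) (s.next false).aut (t.next (s.out false)).aut
        + D (p i) (s.next true).aut (t.next (s.out true)).aut := by
    rw [hrec i _ (aut_mem_G s) _ (aut_mem_G t), Q.state_aut, Q.state_aut, ← Q.state_aut t,
      ← Q.state_aut t]
    rfl
  have aL (i : ι) (t : Q) : D i (Q.aut .a) t.aut = 0 := by
    rw [step]; simp only [Q.next, hleft, add_zero]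
  have aR (i : ι) (t : Q) : D i t.aut (Q.aut .a) = 0 := by
    rw [step]; simp only [Q.next, hright, add_zero]
  -- Each remaining pair of the nucleus splits into pairs already settled; only `(c,d)` and `(d,c)`
  -- need a second step, through `(d,b)` and `(b,d)`.
  have bd (i : ι) : D i (Q.aut .b) (Q.aut .d) = 0 := by
    rw [step]; simp only [Q.next, Q.out, hright, aL, add_zero]
  have db (i : ι) : D i (Q.aut .d) (Q.aut .b) = 0 := by
    rw [step]; simp only [Q.next, Q.out, hleft, aR, add_zero]
  have bc (i : ι) : D i (Q.aut .b) (Q.aut .c) = 0 := by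
    rw [step]; simp only [Q.next, Q.out, aL, aR, add_zero]
  have cb (i : ι) : D i (Q.aut .c) (Q.aut .b) = 0 := by
    rw [step]; simp only [Q.next, Q.out, aL, aR, add_zero]
  have cd (i : ι) : D i (Q.aut .c) (Q.aut .d) = 0 := by
    rw [step]; simp only [Q.next, Q.out, hright, db, add_zero]
  have dc (i : ι) : D i (Q.aut .d) (Q.aut .c) = 0 := by
    rw [step]; simp only [Q.next, Q.out, hleft, bd, add_zero]
  have base (i : ι) (s t : Q) : D i s.aut t.aut = 0 := by
    cases s <;> cases t <;> first
      | exact hleft i _ | exact hright i _ | exact hself i _ | exact aL i _ | exact aR i _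
      | exact bd i | exact db i | exact bc i | exact cb i | exact cd i | exact dc i
  have main (n : ℕ) : ∀ (i : ι) (g h : TreeAut), g ∈ G → h ∈ G → InN n g → InN n h →
      D i g h = 0 := by
    induction n with
    | zero =>
      intro i g h _ _ hg hh
      obtain ⟨s, hs⟩ := (mem_N_iff _).1 (hg [] le_rfl)
      obtain ⟨t, ht⟩ := (mem_N_iff _).1 (hh [] le_rfl)
      rw [state_nil] at hs ht
      rw [hs, ht, base]
    | succ n ih =>
      intro i g h hgG hhG hg hh
      rw [hrec i g hgG h hhG]
      rcases sign_cases g with ⟨-, h1, h2⟩ | ⟨-, h1, h2⟩ <;>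
      rw [h1, h2, ih _ _ _ (state_mem_G hgG _) (state_mem_G hhG _) (hg.state _) (hh.state _),
        ih _ _ _ (state_mem_G hgG _) (state_mem_G hhG _) (hg.state _) (hh.state _), add_zero]
  obtain ⟨m, hm⟩ := contracting hg
  obtain ⟨n, hn⟩ := contracting hh
  exact main (max m n) i g h hg hh (hm.mono (le_max_left _ _)) (hn.mono (le_max_right _ _))

/-! ### The functions `[ξ]` are homomorphisms -/

/-- The recursion of `[ξ]` holds on the nucleus too. -/
theorem count_rec {g : TreeAut} (hg : g ∈ G) (ξ : Letter) :
    count ξ g = countAt false ξ.τ g + countAt true ξ.τ g := by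
  by_cases hN : g ∈ N
  · obtain ⟨s, rfl⟩ := (mem_N_iff _).1 hN
    cases s <;> cases ξ <;>
      simp [countAt, Q.state_aut, count_aut, Q.next, Letter.τ, Letter.q]
  · have hne : g ≠ ξ.elt := by
      rintro rfl
      exact hN (by cases ξ <;> simp [Letter.elt, N])
    rw [count_eq hg, if_neg hne, if_neg hN, Fintype.sum_bool, add_comm]
    rfl

theorem count_one (ξ : Letter) : count ξ 1 = 0 := by
  rw [← Q.aut_e, count_aut]
  cases ξ <;> simp [Letter.q]

/-- Since `(gh)|_x = g|_x h|_{x^g}` and `x ↦ x^g` permutes the two letters, the additivity defect of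
`[ξ]` is the sum of the defects of `[ξ^τ]` at the states. At `(t,t)` it vanishes because `t² = 1`
and the characteristic is two. -/
theorem count_mul (ξ : Letter) {g h : TreeAut} (hg : g ∈ G) (hh : h ∈ G) :
    count ξ (g * h) = count ξ g + count ξ h := by
  suffices H : count ξ (g * h) + count ξ g + count ξ h = 0 by grind
  refine defect_eq_zero Letter.τ (fun ξ g h => count ξ (g * h) + count ξ g + count ξ h)
    ?_ ?_ ?_ ?_ ξ hg hh
  · intro ξ g hg h hh
    simp only [count_rec (mul_mem hg hh), count_rec hg, count_rec hh, countAt, state_mul]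
    rcases sign_cases g with ⟨-, h1, h2⟩ | ⟨-, h1, h2⟩ <;> rw [h1, h2] <;> ring
  · intro ξ t
    simp only [one_mul, count_one]
    grind
  · intro ξ t
    simp only [mul_one, count_one]
    grind
  · intro ξ t
    simp only [Q.aut_mul_self, count_one]
    grind

theorem count_inv (ξ : Letter) {g : TreeAut} (hg : g ∈ G) : count ξ g⁻¹ = count ξ g := by
  have h := count_mul ξ hg (inv_mem hg)
  rw [mul_inv_cancel, count_one] at h
  grind

theorem countAt_mul (x : Bool) (ξ : Letter) {g h : TreeAut} (hg : g ∈ G) (hh : h ∈ G) :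
    countAt x ξ (g * h) = countAt x ξ g + count ξ (state h (img g [x])) := by
  rw [countAt, state_mul, count_mul ξ (state_mem_G hg _) (state_mem_G hh _), countAt]

/-- The action on the second level is determined by the symbols on the first level. -/
theorem sign_state {g : TreeAut} (hg : g ∈ G) (x : Bool) :
    sign (state g [x]) = countAt (!x) .c g + countAt (!x) .d g := by
  have hN (s : Q) (x : Bool) :
      sign (state s.aut [x]) = countAt (!x) .c s.aut + countAt (!x) .d s.aut := by
    cases s <;> cases x <;>
      simp [countAt, Q.state_aut, count_aut, sign_aut, Q.next, Letter.q]
  have hG := hg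
  rw [G] at hg
  induction hg using Subgroup.closure_induction generalizing x with
  | mem g hg =>
    obtain ⟨s, rfl⟩ := (mem_N_iff g).1 (Or.inr hg)
    exact hN s x
  | one => rw [← Q.aut_e]; exact hN .e x
  | mul g h hg hh ihg ihh =>
    -- Both sides obey the same product rule, because `g` sends opposite letters to opposite
    -- letters.
    rw [state_mul, sign_mul, countAt_mul _ _ hg hh, countAt_mul _ _ hg hh, ihg _ hg]
    have hf := ihh false hh
    have ht := ihh true hh
    simp only [countAt, Bool.not_true, Bool.not_false] at hf ht
    rcases sign_cases g with ⟨-, h1, h2⟩ | ⟨-, h1, h2⟩ <;> cases x <;>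
      simp only [Bool.not_true, Bool.not_false, h1, h2, hf, ht] <;> ring
  | inv g hg ih =>
    have hf := ih false hg
    have ht := ih true hg
    simp only [countAt, Bool.not_true, Bool.not_false] at hf ht
    simp only [countAt, state_inv, sign_inv, count_inv _ (state_mem_G hg _)]
    rcases sign_cases g⁻¹ with ⟨-, h1, h2⟩ | ⟨-, h1, h2⟩ <;> cases x <;>
      simp only [Bool.not_true, Bool.not_false, h1, h2, hf, ht]

/-! ### The functions `f₁`, `f₂`, `f₃` on products -/

/-- The functions `f₁`, `f₂`, `f₃`, indexed so that `τ` follows the recursion. -/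
noncomputable def fAt : Letter → TreeAut → ZMod 2
  | .b => f₁
  | .c => f₂
  | .d => f₃

/-- The bilinear forms that measure by how much `f₁`, `f₂`, `f₃` fail to be homomorphisms. -/
noncomputable def cocycle : Letter → TreeAut → TreeAut → ZMod 2
  | .b, g, h => sign g * (count .b h + count .c h) + count .b g * (count .c h + count .d h)
      + count .d g * count .c h
  | .c, g, h => sign g * (count .b h + count .d h) + count .b g * count .d h
      + count .c g * (count .b h + count .d h)
  | .d, g, h => sign g * (count .b h + count .c h) + count .c g * count .b h
      + count .d g * (count .b h + count .c h)

theorem fAt_eq_zero (i : Letter) (s : Q) : fAt i s.aut = 0 := by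
  have h := f_eq_zero ((mem_N_iff _).2 ⟨s, rfl⟩)
  cases i
  exacts [h.1, h.2.1, h.2.2]

/-- The forms in `cocycle` are solutions of the system that the recursions impose: each is the sum
of the next one over the states, plus the defect of the quadratic terms in the recursion of its
function. -/
theorem fAt_mul (i : Letter) {g h : TreeAut} (hg : g ∈ G) (hh : h ∈ G) :
    fAt i (g * h) = fAt i g + fAt i h + cocycle i g h := by
  suffices H : fAt i (g * h) + fAt i g + fAt i h + cocycle i g h = 0 by grind
  have h1 (i : Letter) : fAt i 1 = 0 := by rw [← Q.aut_e]; exact fAt_eq_zero i _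
  refine defect_eq_zero Letter.τ
    (fun i g h => fAt i (g * h) + fAt i g + fAt i h + cocycle i g h) ?_ ?_ ?_ ?_ i hg hh
  · intro i g hg h hh
    have hgh := mul_mem hg hh
    -- The cocycles at the states contain `[∅](g|_x)`. Expressing it by symbols on the first level,
    -- and each `[ξ]` by its recursion, leaves a polynomial identity over `𝔽₂` for each of the two
    -- actions of `g` on the first level.
    have sgf := sign_state hg false
    have sgt := sign_state hg true
    simp only [countAt, Bool.not_true, Bool.not_false] at sgf sgt
    cases i <;>
    simp only [fAt, cocycle, Letter.τ, f₁_eq hgh, f₁_eq hg, f₁_eq hh, f₂_eq hgh, f₂_eq hg,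
      f₂_eq hh, f₃_eq hgh, f₃_eq hg, f₃_eq hh, Fintype.sum_bool, Bool.not_true, Bool.not_false,
      countAt_mul _ _ hg hh, count_rec hg, count_rec hh] <;>
    simp only [countAt, state_mul, sgf, sgt] <;>
    rcases sign_cases g with ⟨h0, h1, h2⟩ | ⟨h0, h1, h2⟩ <;> simp only [h0, h1, h2] <;>
    grind
  · intro i t
    cases i <;> simp [cocycle, h1, fAt_eq_zero, count_one, sign_one]
  · intro i t
    cases i <;> simp [cocycle, h1, fAt_eq_zero, count_one]
  · intro i t
    cases i <;> cases t <;>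
      simp [cocycle, h1, fAt_eq_zero, count_aut, sign_aut, Letter.q, Q.aut_mul_self]

/-- The exponents `e` and `f` on products. -/
theorem expE_mul {g h : TreeAut} (hg : g ∈ G) (hh : h ∈ G) :
    expE (g * h) = expE g + expE h + (count .b g * sign h + count .c g * count .b h
      + count .d g * (sign h + count .b h + count .c h)) := by
  have hf := fAt_mul .d hg hh
  -- If `g` exchanges the subtrees, `[0b] + [0d]` is read on `h` at the letter `1`, which changes it
  -- by `[d](h) + [c](h)`. This cancels all terms with the factor `[∅](g)` that come from `f₃` and
  -- from the product `[∅]([b] + [d])`.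
  have hb := count_rec hh .d
  have hd := count_rec hh .c
  simp only [fAt, cocycle, Letter.τ] at hf hb hd
  rw [expE, expE, expE, hf, sign_mul, count_mul _ hg hh, count_mul _ hg hh, countAt_mul _ _ hg hh,
    countAt_mul _ _ hg hh]
  simp only [countAt] at *
  rcases sign_cases g with ⟨h0, h1, h2⟩ | ⟨h0, h1, h2⟩ <;> simp only [h0, h1] <;> grind

theorem expF_mul {g h : TreeAut} (hg : g ∈ G) (hh : h ∈ G) :
    expF (g * h) = expF g + expF h + (count .c g + count .d g) * sign h := by
  have hb := count_rec hh .d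
  have hd := count_rec hh .c
  simp only [Letter.τ] at hb hd
  rw [expF, expF, expF, sign_mul, count_mul _ hg hh, count_mul _ hg hh, countAt_mul _ _ hg hh,
    countAt_mul _ _ hg hh]
  simp only [countAt] at *
  rcases sign_cases g with ⟨h0, h1, h2⟩ | ⟨h0, h1, h2⟩ <;> simp only [h0, h1] <;> grind

/-! ### Commutators of involutions -/

theorem map_comm {H H' : Type*} [Group H] [Group H'] (φ : H →* H') (x y : H) :
    φ (comm x y) = comm (φ x) (φ y) := by simp [comm]

theorem comm_of_involutions {H : Type*} [Group H] {x y : H} (hx : x * x = 1) (hy : y * y = 1) :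
    comm x y = x * y * x * y := by
  rw [comm, inv_eq_of_mul_eq_one_left hx, inv_eq_of_mul_eq_one_left hy]

theorem mul_swap_of_comm_sq {H : Type*} [Group H] {x y : H} (h : comm x y * comm x y = 1) :
    y * x = x * y * comm x y := by
  have h1 : y * x * comm x y = x * y := by rw [comm]; group
  rw [← h1, mul_assoc, h, mul_one]

/-- An involution `x` inverts `[x,y] = (xy)²` by conjugation, and here the inverse is the element
itself. -/
theorem commute_comm_left {H : Type*} [Group H] {x y : H} (hx : x * x = 1) (hy : y * y = 1)
    (h : comm x y * comm x y = 1) : comm x y * x = x * comm x y := by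
  have h1 : x * comm x y = (comm x y)⁻¹ * x := by
    rw [comm, inv_eq_of_mul_eq_one_left hx, inv_eq_of_mul_eq_one_left hy, mul_inv_rev, mul_inv_rev,
      mul_inv_rev, inv_eq_of_mul_eq_one_left hx, inv_eq_of_mul_eq_one_left hy]
    simp only [mul_assoc, hx, mul_one]
    rw [← mul_assoc, hx, one_mul]
  rw [h1, inv_eq_of_mul_eq_one_left h]

theorem commute_comm_right {H : Type*} [Group H] {x y : H} (hx : x * x = 1) (hy : y * y = 1)
    (h : comm x y * comm x y = 1) : comm x y * y = y * comm x y := by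
  have h1 : comm y x = comm x y := by
    rw [← inv_eq_of_mul_eq_one_left h, comm, comm]
    group
  rw [← h1] at h ⊢
  exact commute_comm_left hy hx h

/-! ### A model of `Γ` -/

/-- The group of order `64` of normal forms `a^s b^b c^c d^d [a,b]^z [a,c]^w`. -/
@[ext]
structure Model where
  s : ZMod 2
  b : ZMod 2
  c : ZMod 2
  d : ZMod 2
  z : ZMod 2
  w : ZMod 2
  deriving DecidableEq

namespace Model

instance : Mul Model where
  mul m n := ⟨m.s + n.s, m.b + n.b, m.c + n.c, m.d + n.d,
    m.z + n.z + (m.b * n.s + m.c * n.b + m.d * (n.s + n.b + n.c)),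
    m.w + n.w + (m.c + m.d) * n.s⟩

instance : One Model where
  one := ⟨0, 0, 0, 0, 0, 0⟩

instance : Inv Model where
  inv m := ⟨m.s, m.b, m.c, m.d, m.z + (m.b * m.s + m.c * m.b + m.d * (m.s + m.b + m.c)),
    m.w + (m.c + m.d) * m.s⟩

theorem mul_def (m n : Model) : m * n = ⟨m.s + n.s, m.b + n.b, m.c + n.c, m.d + n.d,
    m.z + n.z + (m.b * n.s + m.c * n.b + m.d * (n.s + n.b + n.c)),
    m.w + n.w + (m.c + m.d) * n.s⟩ := rfl

theorem one_def : (1 : Model) = ⟨0, 0, 0, 0, 0, 0⟩ := rfl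

theorem inv_def (m : Model) : m⁻¹ =
    ⟨m.s, m.b, m.c, m.d, m.z + (m.b * m.s + m.c * m.b + m.d * (m.s + m.b + m.c)),
      m.w + (m.c + m.d) * m.s⟩ := rfl

instance : Group Model := Group.ofLeftAxioms
  (fun m n k => by simp only [mul_def, mk.injEq]; refine ⟨?_, ?_, ?_, ?_, ?_, ?_⟩ <;> ring)
  (fun m => by simp [mul_def, one_def])
  (fun m => by
    simp only [mul_def, one_def, inv_def, mk.injEq]
    refine ⟨?_, ?_, ?_, ?_, ?_, ?_⟩ <;> grind)

theorem card : Nat.card Model = 2 ^ 6 := by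
  let E : Model ≃ ZMod 2 × ZMod 2 × ZMod 2 × ZMod 2 × ZMod 2 × ZMod 2 :=
    { toFun := fun m => (m.s, m.b, m.c, m.d, m.z, m.w)
      invFun := fun p => ⟨p.1, p.2.1, p.2.2.1, p.2.2.2.1, p.2.2.2.2.1, p.2.2.2.2.2⟩
      left_inv := fun _ => rfl
      right_inv := fun _ => rfl }
  rw [Nat.card_congr E]
  simp

/-- The elements of the model named by the generators of `Γ`. -/
def gen : Gen → Model
  | .a => ⟨1, 0, 0, 0, 0, 0⟩
  | .b => ⟨0, 1, 0, 0, 0, 0⟩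
  | .c => ⟨0, 0, 1, 0, 0, 0⟩
  | .d => ⟨0, 0, 0, 1, 0, 0⟩

theorem lift_rels : ∀ r ∈ rels, FreeGroup.lift gen r = 1 := by
  intro r hr
  simp only [rels, Set.mem_insert_iff, Set.mem_singleton_iff] at hr
  rcases hr with rfl | rfl | rfl | rfl | rfl | rfl | rfl | rfl | rfl | rfl <;>
    simp only [map_mul, map_pow, map_inv, map_comm, FreeGroup.lift_apply_of] <;> decide

/-- The homomorphism from `Γ` to the model. -/
def ofGam : Gam →* Model := PresentedGroup.toGroup lift_rels

theorem ofGam_gam (s : Gen) : ofGam (gam s) = gen s := PresentedGroup.toGroup.of lift_rels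

/-- The element of `Γ` with a given normal form. -/
def toGam (m : Model) : Gam :=
  gam .a ^ m.s.val * gam .b ^ m.b.val * gam .c ^ m.c.val * gam .d ^ m.d.val
    * comm (gam .a) (gam .b) ^ m.z.val * comm (gam .a) (gam .c) ^ m.w.val

theorem ofGam_toGam (m : Model) : ofGam (toGam m) = m := by
  have ha : ∀ i : ZMod 2, gen .a ^ i.val = ⟨i, 0, 0, 0, 0, 0⟩ := by decide
  have hb : ∀ i : ZMod 2, gen .b ^ i.val = ⟨0, i, 0, 0, 0, 0⟩ := by decide
  have hc : ∀ i : ZMod 2, gen .c ^ i.val = ⟨0, 0, i, 0, 0, 0⟩ := by decide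
  have hd : ∀ i : ZMod 2, gen .d ^ i.val = ⟨0, 0, 0, i, 0, 0⟩ := by decide
  have hz : ∀ i : ZMod 2, comm (gen .a) (gen .b) ^ i.val = ⟨0, 0, 0, 0, i, 0⟩ := by decide
  have hw : ∀ i : ZMod 2, comm (gen .a) (gen .c) ^ i.val = ⟨0, 0, 0, 0, 0, i⟩ := by decide
  simp only [toGam, map_mul, map_pow, map_comm, ofGam_gam, ha, hb, hc, hd, hz, hw]
  simp [mul_def]

end Model

/-! ### Normal forms in `Γ` -/

theorem mk_rel {r : FreeGroup Gen} (h : r ∈ rels) : PresentedGroup.mk rels r = 1 :=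
  PresentedGroup.one_of_mem h

theorem gam_sq (s : Gen) : gam s * gam s = 1 := by
  rw [← pow_two]
  have h : FreeGroup.of s ^ 2 ∈ rels := by cases s <;> simp [rels]
  have h1 := mk_rel h
  rwa [map_pow] at h1

theorem comm_ab_sq : comm (gam .a) (gam .b) * comm (gam .a) (gam .b) = 1 := by
  rw [← pow_two]
  have h := mk_rel (r := comm (FreeGroup.of .a) (FreeGroup.of .b) ^ 2) (by simp [rels])
  rwa [map_pow, map_comm] at h

theorem comm_ac_sq : comm (gam .a) (gam .c) * comm (gam .a) (gam .c) = 1 := by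
  rw [← pow_two]
  have h := mk_rel (r := comm (FreeGroup.of .a) (FreeGroup.of .c) ^ 2) (by simp [rels])
  rwa [map_pow, map_comm] at h

theorem comm_bc_eq : comm (gam .b) (gam .c) = comm (gam .a) (gam .b) := by
  have h := mk_rel (r := comm (FreeGroup.of .a) (FreeGroup.of .b)
    * (comm (FreeGroup.of .b) (FreeGroup.of .c))⁻¹) (by simp [rels])
  rw [map_mul, map_inv, map_comm, map_comm, mul_inv_eq_one] at h
  exact h.symm

theorem comm_cd_eq : comm (gam .c) (gam .d) = comm (gam .a) (gam .b) := by
  have h := mk_rel (r := comm (FreeGroup.of .b) (FreeGroup.of .c)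
    * (comm (FreeGroup.of .c) (FreeGroup.of .d))⁻¹) (by simp [rels])
  rw [map_mul, map_inv, map_comm, map_comm, mul_inv_eq_one] at h
  exact h.symm.trans comm_bc_eq

theorem comm_db_eq : comm (gam .d) (gam .b) = comm (gam .a) (gam .b) := by
  have h := mk_rel (r := comm (FreeGroup.of .c) (FreeGroup.of .d)
    * (comm (FreeGroup.of .d) (FreeGroup.of .b))⁻¹) (by simp [rels])
  rw [map_mul, map_inv, map_comm, map_comm, mul_inv_eq_one] at h
  exact h.symm.trans comm_cd_eq

theorem comm_ad_eq : comm (gam .a) (gam .d) =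
    comm (gam .a) (gam .b) * comm (gam .a) (gam .c) := by
  have h := mk_rel (r := comm (FreeGroup.of .a) (FreeGroup.of .d)
    * (comm (FreeGroup.of .a) (FreeGroup.of .b) * comm (FreeGroup.of .a) (FreeGroup.of .c))⁻¹)
    (by simp [rels])
  rwa [map_mul, map_inv, map_mul, map_comm, map_comm, map_comm, mul_inv_eq_one] at h

/-- The element equals `[b,c]` and `[c,d]` too, and a commutator of two involutions that squares to
`1` commutes with both of them. -/
theorem commute_comm_ab (s : Gen) : Commute (comm (gam .a) (gam .b)) (gam s) := by
  cases s
  · exact commute_comm_left (gam_sq _) (gam_sq _) comm_ab_sq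
  · exact commute_comm_right (gam_sq _) (gam_sq _) comm_ab_sq
  · have h := comm_ab_sq
    rw [← comm_bc_eq] at h ⊢
    exact commute_comm_right (gam_sq _) (gam_sq _) h
  · have h := comm_ab_sq
    rw [← comm_cd_eq] at h ⊢
    exact commute_comm_right (gam_sq _) (gam_sq _) h

theorem commute_of_commute_gam {x : Gam} (h : ∀ s, Commute x (gam s)) (y : Gam) :
    Commute x y := by
  have hy : y ∈ Subgroup.closure (Set.range (PresentedGroup.of (rels := rels))) := by
    rw [PresentedGroup.closure_range_of]; trivial
  induction hy using Subgroup.closure_induction with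
  | mem y hy => obtain ⟨s, rfl⟩ := hy; exact h s
  | one => exact Commute.one_right x
  | mul y z _ _ hy hz => exact hy.mul_right hz
  | inv y _ hy => exact hy.inv_right

theorem comm_ab_central (y : Gam) : Commute (comm (gam .a) (gam .b)) y :=
  commute_of_commute_gam commute_comm_ab y

theorem gam_ba : gam .b * gam .a = gam .a * gam .b * comm (gam .a) (gam .b) :=
  mul_swap_of_comm_sq comm_ab_sq

theorem gam_cb : gam .c * gam .b = gam .b * gam .c * comm (gam .a) (gam .b) := by
  have h := comm_ab_sq
  rw [← comm_bc_eq] at h ⊢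
  exact mul_swap_of_comm_sq h

theorem gam_dc : gam .d * gam .c = gam .c * gam .d * comm (gam .a) (gam .b) := by
  have h := comm_ab_sq
  rw [← comm_cd_eq] at h ⊢
  exact mul_swap_of_comm_sq h

theorem gam_db : gam .d * gam .b = gam .b * gam .d * comm (gam .a) (gam .b) := by
  have h := comm_ab_sq
  rw [← comm_db_eq] at h
  have h1 := mul_swap_of_comm_sq h
  rw [comm_db_eq] at h1
  rw [h1, mul_assoc, comm_ab_sq, mul_one]

theorem gam_ca : gam .c * gam .a = gam .a * gam .c * comm (gam .a) (gam .c) :=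
  mul_swap_of_comm_sq comm_ac_sq

theorem comm_ad_sq : comm (gam .a) (gam .d) * comm (gam .a) (gam .d) = 1 := by
  rw [comm_ad_eq, (comm_ab_central _).symm.mul_mul_mul_comm, comm_ab_sq, comm_ac_sq, one_mul]

theorem gam_da : gam .d * gam .a =
    gam .a * gam .d * (comm (gam .a) (gam .b) * comm (gam .a) (gam .c)) := by
  rw [← comm_ad_eq]
  exact mul_swap_of_comm_sq comm_ad_sq

/-- For `a` and `c` this is the general fact on involutions. For `d` that fact applies to `[a,d] =
z[a,c]` with `z = [a,b]` central. For `b`, moving `b` through `acac` produces four factors `z`,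
which cancel. -/
theorem commute_comm_ac (s : Gen) : Commute (comm (gam .a) (gam .c)) (gam s) := by
  cases s
  · exact commute_comm_left (gam_sq _) (gam_sq _) comm_ac_sq
  · have hab (x : Gam) : gam .b * (gam .a * x) =
        gam .a * (gam .b * (comm (gam .a) (gam .b) * x)) := by
      rw [← mul_assoc, gam_ba]; simp only [mul_assoc]
    have hbc (x : Gam) : gam .b * (gam .c * x) =
        gam .c * (gam .b * (comm (gam .a) (gam .b) * x)) := by
      rw [← mul_assoc (gam .c), gam_cb]
      simp only [mul_assoc]
      rw [← mul_assoc (comm _ _), comm_ab_sq, one_mul]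
    have hz := comm_ab_sq
    have hza := (comm_ab_central (gam .a)).left_comm
    have hzc := (comm_ab_central (gam .c)).left_comm
    have hzz (x : Gam) : comm (gam .a) (gam .b) * (comm (gam .a) (gam .b) * x) = x := by
      rw [← mul_assoc, comm_ab_sq, one_mul]
    rw [comm_of_involutions (gam_sq .a) (gam_sq .c)]
    generalize comm (gam .a) (gam .b) = z at *
    have key (x : Gam) : gam .b * (gam .a * (gam .c * (gam .a * (gam .c * x))))
        = gam .a * (gam .c * (gam .a * (gam .c * (gam .b * x)))) := by
      simp only [hab, hbc, hza, hzc, hzz]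
    have := key 1
    simp only [mul_one] at this
    simp only [Commute, SemiconjBy, mul_assoc, this]
  · exact commute_comm_right (gam_sq _) (gam_sq _) comm_ac_sq
  · have h : Commute (comm (gam .a) (gam .d)) (gam .d) :=
      commute_comm_right (gam_sq _) (gam_sq _) comm_ad_sq
    have h1 : comm (gam .a) (gam .c) = comm (gam .a) (gam .b) * comm (gam .a) (gam .d) := by
      rw [comm_ad_eq, ← mul_assoc, comm_ab_sq, one_mul]
    rw [h1]
    exact (comm_ab_central _).mul_left h

theorem comm_ac_central (y : Gam) : Commute (comm (gam .a) (gam .c)) y :=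
  commute_of_commute_gam commute_comm_ac y

theorem pow_val_add_one {H : Type*} [Group H] {x : H} (hx : x * x = 1) (i : ZMod 2) :
    x ^ (i + 1).val = x ^ i.val * x := by
  have h : i = 0 ∨ i = 1 := by revert i; decide
  rcases h with rfl | rfl
  · simp [ZMod.val_one]
  · rw [show (1 + 1 : ZMod 2) = 0 from rfl]; simp [ZMod.val_one, hx]

-- The isomorphism between the model and `Γ`

namespace Model

theorem toGam_mul_gen (m : Model) (s : Gen) : toGam m * gam s = toGam (m * gen s) := by
  -- The trailing factor `x` lets each collection rule, stated for right-nested products, apply at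
  -- the end of a word as well.
  suffices H : ∀ x, toGam m * gam s * x = toGam (m * gen s) * x by simpa using H 1
  intro x
  have cases2 : ∀ i : ZMod 2, i = 0 ∨ i = 1 := by decide
  have Z := comm_ab_central
  have W := comm_ac_central
  have hz := comm_ab_sq
  have hw := comm_ac_sq
  have hba (x : Gam) := congrArg (· * x) gam_ba
  have hca (x : Gam) := congrArg (· * x) gam_ca
  have hda (x : Gam) := congrArg (· * x) gam_da
  have hcb (x : Gam) := congrArg (· * x) gam_cb
  have hdb (x : Gam) := congrArg (· * x) gam_db
  have hdc (x : Gam) := congrArg (· * x) gam_dc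
  have hzz (x : Gam) := congrArg (· * x) comm_ab_sq
  have hww (x : Gam) := congrArg (· * x) comm_ac_sq
  have Zg (s) := (Z (gam s)).left_comm
  have Wg (s) := (W (gam s)).left_comm
  have Zg' (s) := ((Z (gam s)).pow_left m.z.val).left_comm
  have Wg' (s) := ((W (gam s)).pow_left m.w.val).left_comm
  have zZ := ((Z _).pow_right m.z.val : Commute _ (comm (gam .a) (gam .b) ^ _)).left_comm
  have wZ := ((W _).pow_right m.z.val : Commute _ (comm (gam .a) (gam .b) ^ _)).left_comm
  have wz := (W (comm (gam .a) (gam .b))).left_comm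
  have wW := ((W _).pow_right m.w.val : Commute _ (comm (gam .a) (gam .c) ^ _)).left_comm
  have pa := pow_val_add_one (gam_sq .a)
  have hbb (x : Gam) := congrArg (· * x) (gam_sq .b)
  have hcc (x : Gam) := congrArg (· * x) (gam_sq .c)
  have hdd (x : Gam) := congrArg (· * x) (gam_sq .d)
  have pz := pow_val_add_one hz
  have pw := pow_val_add_one hw
  obtain ⟨i, j, k, l, p, q⟩ := m
  simp only [mul_assoc, one_mul] at *
  have h11 : (1 : ZMod 2) + 1 = 0 := rfl
  simp only [toGam, mul_def]
  generalize comm (gam .a) (gam .b) = z at *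
  generalize comm (gam .a) (gam .c) = w at *
  -- Only the exponents of `b`, `c`, `d` need cases: `a` stands first and `z`, `w` are central, so
  -- their exponents stay symbolic.
  rcases cases2 j with rfl | rfl <;> rcases cases2 k with rfl | rfl <;>
    rcases cases2 l with rfl | rfl <;> cases s <;>
    simp only [gen, pa, pz, pw, add_zero, zero_add, mul_zero, mul_one, h11,
      ZMod.val_zero, ZMod.val_one, pow_zero, pow_one, mul_assoc, hba, hca, hda,
      hcb, hdb, hdc, hzz, hww, hbb, hcc, hdd, Zg, Wg, Zg', Wg', zZ, wZ, wz, wW]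

/-- At `m = 1` this says that every `y` equals its normal form, so that `toGam` is a two-sided
inverse of `ofGam`. -/
theorem toGam_mul_eq (y : Gam) (m : Model) : toGam m * y = toGam (m * ofGam y) := by
  have hy : y ∈ Subgroup.closure (Set.range (PresentedGroup.of (rels := rels))) := by
    rw [PresentedGroup.closure_range_of]; trivial
  induction hy using Subgroup.closure_induction generalizing m with
  | mem y hy =>
    obtain ⟨s, rfl⟩ := hy
    exact (toGam_mul_gen m s).trans (by rw [← ofGam_gam]; rfl)
  | one => rw [map_one, mul_one, mul_one]
  | mul y z _ _ hy hz => rw [← mul_assoc, hy, hz, map_mul, mul_assoc]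
  | inv y _ hy => rw [mul_inv_eq_iff_eq_mul, hy, map_inv, inv_mul_cancel_right]

theorem toGam_one : toGam 1 = 1 := by simp [toGam, one_def]

/-- The model is isomorphic to `Γ`. -/
def equivGam : Model ≃* Gam :=
  MulEquiv.symm
    { ofGam with
      invFun := toGam
      left_inv := fun y => by
        have h := toGam_mul_eq y 1
        rw [toGam_one, one_mul, one_mul] at h
        exact h.symm
      right_inv := ofGam_toGam }

theorem equivGam_gen (s : Gen) : equivGam (gen s) = gam s := by
  have h := toGam_mul_gen 1 s
  rw [toGam_one, one_mul, one_mul] at h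
  exact h.symm

end Model

theorem card_gam : Nat.card Gam = 2 ^ 6 := by
  rw [← Nat.card_congr Model.equivGam.toEquiv, Model.card]

theorem isNilpotent_gam : Group.IsNilpotent Gam := by
  have : Finite Gam := Nat.finite_of_card_ne_zero (by rw [card_gam]; norm_num)
  exact (IsPGroup.of_card (p := 2) card_gam).isNilpotent

/-! ### The homomorphism from `G` to the model -/

theorem G_closure : Subgroup.closure {gA, gB, gC, gD} = (⊤ : Subgroup G) := by
  rw [← Subgroup.map_injective G.subtype_injective |>.eq_iff, MonoidHom.map_closure,
    ← MonoidHom.range_eq_map, Subgroup.range_subtype]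
  simp only [Set.image_insert_eq, Set.image_singleton]
  rfl

/-- The exponents of `π` as a homomorphism to the model. -/
noncomputable def coords : G →* Model :=
  MonoidHom.mk'
    (fun g => ⟨sign g, count .b g, count .c g, count .d g, expE g, expF g⟩)
    (fun g h => by
      simp only [Subgroup.coe_mul, Model.mul_def, sign_mul, count_mul _ g.2 h.2,
        expE_mul g.2 h.2, expF_mul g.2 h.2])

theorem coords_aut (s : Q) (g : G) (hg : (g : TreeAut) = s.aut) : coords g =
    ⟨if s = .a then 1 else 0, if s = .b then 1 else 0, if s = .c then 1 else 0,
      if s = .d then 1 else 0, 0, 0⟩ := by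
  have h := fAt_eq_zero .d s
  simp only [fAt] at h
  simp only [coords, MonoidHom.mk'_apply, hg, expE, expF, countAt, Q.state_aut, count_aut, sign_aut,
    Letter.q, h, Model.mk.injEq]
  cases s <;> simp [Q.next]

theorem coords_gA : coords gA = Model.gen .a := (coords_aut .a gA rfl).trans (by simp [Model.gen])
theorem coords_gB : coords gB = Model.gen .b := (coords_aut .b gB rfl).trans (by simp [Model.gen])
theorem coords_gC : coords gC = Model.gen .c := (coords_aut .c gC rfl).trans (by simp [Model.gen])
theorem coords_gD : coords gD = Model.gen .d := (coords_aut .d gD rfl).trans (by simp [Model.gen])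

/-- The homomorphism `π`. -/
noncomputable def piHom : G →* Gam := Model.equivGam.toMonoidHom.comp coords

theorem piHom_apply (g : G) : piHom g = piMap g := rfl

theorem piHom_gA : piHom gA = gam .a :=
  (congrArg Model.equivGam coords_gA).trans (Model.equivGam_gen .a)
theorem piHom_gB : piHom gB = gam .b :=
  (congrArg Model.equivGam coords_gB).trans (Model.equivGam_gen .b)
theorem piHom_gC : piHom gC = gam .c :=
  (congrArg Model.equivGam coords_gC).trans (Model.equivGam_gen .c)
theorem piHom_gD : piHom gD = gam .d :=
  (congrArg Model.equivGam coords_gD).trans (Model.equivGam_gen .d)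

theorem piHom_surjective : Function.Surjective piHom := by
  rw [← MonoidHom.range_eq_top, eq_top_iff, ← PresentedGroup.closure_range_of rels,
    Subgroup.closure_le]
  rintro _ ⟨s, rfl⟩
  cases s
  exacts [⟨gA, piHom_gA⟩, ⟨gB, piHom_gB⟩, ⟨gC, piHom_gC⟩, ⟨gD, piHom_gD⟩]

theorem ker_piHom : piHom.ker = coords.ker := by
  ext g
  rw [MonoidHom.mem_ker, MonoidHom.mem_ker]
  exact map_eq_one_iff Model.equivGam Model.equivGam.injective

/-! ### The kernel contains `C` -/

/-- Modulo the central `z` and `w` these elements are the powers of `bcd`. The condition thus covers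
the images of all generators of `K`. -/
theorem Model.mem_center {m : Model} (hs : m.s = 0) (hb : m.b = m.c) (hc : m.c = m.d) :
    m ∈ Subgroup.center Model := by
  rw [Subgroup.mem_center_iff]
  intro n
  simp only [mul_def, mk.injEq, hs, hb, hc]
  refine ⟨?_, ?_, ?_, ?_, ?_, ?_⟩ <;> grind

theorem K_le_center : K ≤ (Subgroup.center Model).comap coords := by
  refine Subgroup.normalClosure_le_normal ?_
  rintro _ (rfl | rfl | rfl | rfl | rfl) <;>
    simp only [SetLike.mem_coe, Subgroup.mem_comap, map_comm, map_mul, coords_gA, coords_gB,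
      coords_gC, coords_gD] <;>
    exact Model.mem_center (by decide) (by decide) (by decide)

theorem C_le_ker : C ≤ coords.ker := by
  refine sup_le (Subgroup.commutator_le.2 fun k hk g _ => ?_) ?_
  · rw [MonoidHom.mem_ker, map_commutatorElement, commutatorElement_eq_one_iff_mul_comm]
    exact (Subgroup.mem_center_iff.1 (K_le_center hk) _).symm
  · rw [Subgroup.closure_le, Set.singleton_subset_iff, SetLike.mem_coe, MonoidHom.mem_ker, map_mul,
      map_comm, map_comm, coords_gA, coords_gB, coords_gC]
    decide

/-! ### The relations of `Γ` modulo `C` -/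

instance : K.Normal := Subgroup.normalClosure_normal

theorem mem_K_of_generator {x : G}
    (h : x ∈ ({comm gA gB, comm gB gC, comm gB gD, comm gC gD, gB * gC * gD} : Set G)) : x ∈ K :=
  Subgroup.subset_normalClosure h

theorem C_le_K : C ≤ K := by
  refine sup_le (Subgroup.commutator_le_left _ _) ?_
  rw [Subgroup.closure_le, Set.singleton_subset_iff]
  exact mul_mem (mem_K_of_generator (by simp)) (mem_K_of_generator (by simp))

open scoped commutatorElement in
theorem commutator_mem_C {k : G} (hk : k ∈ K) (g : G) : ⁅k, g⁆ ∈ C :=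
  Subgroup.mem_sup_left (Subgroup.commutator_mem_commutator hk trivial)

open scoped commutatorElement in
instance : C.Normal where
  -- A conjugate of `c` differs from `c` by a commutator in `[K, G]`, because `C ≤ K`.
  conj_mem c hc g := by
    have h : g * c * g⁻¹ = (⁅c, g⁆)⁻¹ * c := by rw [commutatorElement_def]; group
    rw [h]
    exact mul_mem (inv_mem (commutator_mem_C (C_le_K hc) g)) hc

open scoped commutatorElement in
theorem commute_mk_C {k : G} (hk : k ∈ K) (g : G) :
    Commute (QuotientGroup.mk' C k) (QuotientGroup.mk' C g) := by
  have h : QuotientGroup.mk' C ⁅k, g⁆ = 1 :=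
    (QuotientGroup.eq_one_iff _).2 (commutator_mem_C hk g)
  rwa [map_commutatorElement, commutatorElement_eq_one_iff_commute] at h

/-- Conjugation by `a` both inverts and fixes `[a,b] = abab`. -/
theorem comm_sq_of_commute {H : Type*} [Group H] {a b : H} (ha : a * a = 1) (hb : b * b = 1)
    (h : Commute (comm a b) a) : comm a b * comm a b = 1 := by
  have h1 : comm a b * comm a b = comm a b * a * (b * a * b) := by
    nth_rw 2 [comm_of_involutions ha hb]
    simp only [mul_assoc]
  have haa (x : H) : a * (a * x) = x := by rw [← mul_assoc, ha, one_mul]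
  have hbb (x : H) : b * (b * x) = x := by rw [← mul_assoc, hb, one_mul]
  rw [h1, h.eq, comm_of_involutions ha hb]
  simp only [mul_assoc, haa, hbb, hb]

/-- Four involutions `a`, `b`, `c`, `d` with `(ad)⁴ = 1` satisfy the relations of `Γ` as soon as
`[a,b]` and `bcd` are central and `[a,b][b,c] = 1`. -/
theorem gam_relations {H : Type*} [Group H] {a b c d : H} (ha : a * a = 1) (hb : b * b = 1)
    (hc : c * c = 1) (hd : d * d = 1) (had : comm a d * comm a d = 1)
    (za : Commute (comm a b) a) (zc : Commute (comm a b) c)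
    (ka : Commute (b * c * d) a) (kb : Commute (b * c * d) b) (kc : Commute (b * c * d) c)
    (kd : Commute (b * c * d) d) (hz : comm a b * comm b c = 1) :
    comm a b * comm a b = 1 ∧ comm a c * comm a c = 1 ∧ comm a b = comm b c ∧
      comm b c = comm c d ∧ comm c d = comm d b ∧ comm a d = comm a b * comm a c := by
  have zz := comm_sq_of_commute ha hb za
  have hbc : comm a b = comm b c := by
    rw [← mul_right_inj (comm a b), zz, hz]
  obtain ⟨k, hk⟩ : ∃ k, k = b * c * d := ⟨_, rfl⟩
  rw [← hk] at ka kb kc kd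
  have bb (x : H) : b * (b * x) = x := by rw [← mul_assoc, hb, one_mul]
  have cc (x : H) : c * (c * x) = x := by rw [← mul_assoc, hc, one_mul]
  have dd (x : H) : d * (d * x) = x := by rw [← mul_assoc, hd, one_mul]
  have e1 : b * c = k * d := by rw [hk]; simp only [mul_assoc, hd, mul_one]
  have e2 : c * d = k * b := by rw [kb.eq, hk]; simp only [mul_assoc, bb]
  have e3 : d * b = k * c := by
    have h : c * (d * b) = k := by rw [← mul_assoc, e2, mul_assoc, hb, mul_one]
    rw [kc.eq, ← h, cc]
  -- Since `k = bcd` is central, `bc = kd`, `cd = kb` and `db = kc`; squaring shows that all three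
  -- commutators equal `k²`.
  have sq {x y u : H} (hx : x * x = 1) (hy : y * y = 1) (hu : u * u = 1) (ku : Commute k u)
      (h : x * y = k * u) : comm x y = k * k := by
    rw [comm_of_involutions hx hy, mul_assoc, h, ku.symm.mul_mul_mul_comm, hu, mul_one]
  have s1 := sq hb hc hd kd e1
  have s2 := sq hc hd hb kb e2
  have s3 := sq hd hb hc kc e3
  -- The element `(abc)²` is computed in two ways. From `bc = kd` it is `k²(ad)² = [a,b][a,d]`; from
  -- `cab = bca`, where two factors `[a,b]` cancel, it is `acac = [a,c]`.
  have hac : comm a d = comm a b * comm a c := by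
    have hba := mul_swap_of_comm_sq zz
    have hab : a * b = b * a * comm a b := by rw [hba, mul_assoc, zz, mul_one]
    have hcb : c * b = b * c * comm a b := by
      rw [hbc] at zz ⊢
      exact mul_swap_of_comm_sq zz
    have hcab : c * a * b = b * (c * a) := by
      rw [mul_assoc, hab, ← mul_assoc, ← mul_assoc, hcb, mul_assoc (b * c), za.eq]
      simp only [mul_assoc, zz, mul_one]
    have hk2 : comm a b * comm a d = a * (b * c) * (a * (b * c)) := by
      rw [hbc, s1, e1, ← mul_assoc a k d, ← ka.eq, mul_assoc k a d,
        ((ka.mul_right kd).symm.mul_mul_mul_comm k (a * d) :), comm_of_involutions ha hd]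
      simp only [mul_assoc]
    have hac' : a * (b * c) * (a * (b * c)) = comm a c := by
      calc a * (b * c) * (a * (b * c)) = a * b * (c * a * b) * c := by simp only [mul_assoc]
        _ = comm a c := by
          rw [hcab, comm_of_involutions ha hc]
          simp only [mul_assoc, bb]
    rw [← hac', ← hk2, ← mul_assoc, zz, one_mul]
  refine ⟨zz, ?_, hbc, s1.trans s2.symm, s2.trans s3.symm, hac⟩
  -- Squaring `[a,d] = [a,b][a,c]`, whose factors commute, turns `[a,d]² = 1` into `[a,c]² = 1`.
  have hw : Commute (comm a b) (comm a c) := by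
    rw [comm_of_involutions ha hc]
    exact ((za.mul_right zc).mul_right za).mul_right zc
  rwa [hac, hw.symm.mul_mul_mul_comm, zz, one_mul] at had

/-- As `d = (1,b)` and `ada = (b,1)`, the commutator `adad` is `(b,b)`, an involution. Apart from
the orders of the generators, this is the only relation of `G` itself that is used in `G/C`. -/
theorem aut_ad_pow : comm gA gD * comm gA gD = 1 := by
  have hA : gA * gA = 1 := Subtype.ext (Q.aut_mul_self .a)
  have hD : gD * gD = 1 := Subtype.ext (Q.aut_mul_self .d)
  have he (w : List Bool) : Q.run .e w = w := congrArg (img · w) Q.aut_e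
  rw [comm_of_involutions hA hD]
  refine Subtype.ext (treeAut_ext fun w => ?_)
  simp only [Subgroup.coe_mul, img_mul, Subgroup.coe_one, img_one, gA, gD, tA, tD, Q.img_aut]
  match w with
  | [] => rfl
  | false :: w => simp [Q.run, Q.out, Q.next, he, Q.run_run]
  | true :: w => simp [Q.run, Q.out, Q.next, he, Q.run_run]

/-- The relations of `Γ` hold in `G/C`, so the quotient map factors through `π`; the factorization
is checked on generators. -/
theorem ker_le_C : piHom.ker ≤ C := by
  let q := QuotientGroup.mk' C
  have sq {g : G} (s : Q) (hg : (g : TreeAut) = s.aut) : q g * q g = 1 := by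
    have : g * g = 1 := Subtype.ext (by simp [hg, Q.aut_mul_self])
    rw [← map_mul, this, map_one]
  have kz : comm gA gB ∈ K := mem_K_of_generator (by simp)
  have kk : gB * gC * gD ∈ K := mem_K_of_generator (by simp)
  have cz (g : G) : Commute (comm (q gA) (q gB)) (q g) := by
    rw [← map_comm]; exact commute_mk_C kz g
  have ck (g : G) : Commute (q gB * q gC * q gD) (q g) := by
    rw [← map_mul, ← map_mul]; exact commute_mk_C kk g
  have ha := sq (g := gA) .a rfl
  have hb := sq (g := gB) .b rfl
  have hc := sq (g := gC) .c rfl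
  have hd := sq (g := gD) .d rfl
  obtain ⟨r1, r2, r3, r4, r5, r6⟩ := gam_relations ha hb hc hd
    (by rw [← map_comm, ← map_mul, aut_ad_pow, map_one]) (cz _) (cz _) (ck _) (ck _)
    (ck _) (ck _)
    (by
      rw [← map_comm, ← map_comm, ← map_mul]
      exact (QuotientGroup.eq_one_iff _).2
        (Subgroup.mem_sup_right (Subgroup.subset_closure (Set.mem_singleton _))))
  let F : Gen → G ⧸ C
    | .a => q gA
    | .b => q gB
    | .c => q gC
    | .d => q gD
  have hF : ∀ r ∈ rels, FreeGroup.lift F r = 1 := by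
    intro r hr
    simp only [rels, Set.mem_insert_iff, Set.mem_singleton_iff] at hr
    rcases hr with rfl | rfl | rfl | rfl | rfl | rfl | rfl | rfl | rfl | rfl <;>
      simp only [map_mul, map_inv, map_comm, FreeGroup.lift_apply_of, pow_two, mul_inv_eq_one, F]
    exacts [ha, hb, hc, hd, r1, r2, r3, r4, r5, r6]
  have hcomp : (PresentedGroup.toGroup hF).comp piHom = q := by
    refine MonoidHom.eq_of_eqOn_dense G_closure ?_
    have hof (s : Gen) : PresentedGroup.toGroup hF (gam s) = F s := PresentedGroup.toGroup.of hF
    rintro _ (rfl | rfl | rfl | rfl) <;>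
      simp only [MonoidHom.comp_apply, piHom_gA, piHom_gB, piHom_gC, piHom_gD, hof, F]
  intro g hg
  rw [MonoidHom.mem_ker] at hg
  refine (QuotientGroup.eq_one_iff g).1 ?_
  have h : q g = 1 := by rw [← hcomp, MonoidHom.comp_apply, hg, map_one]
  exact h

end TwistedTwin

theorem theorem6 :
    Group.IsNilpotent TwistedTwin.Gam ∧ Nat.card TwistedTwin.Gam = 2 ^ 6 ∧
      ∃ π : TwistedTwin.G →* TwistedTwin.Gam,
        (∀ g : TwistedTwin.G, π g = TwistedTwin.piMap g) ∧
        Function.Surjective π ∧ π.ker = TwistedTwin.C :=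
  ⟨TwistedTwin.isNilpotent_gam, TwistedTwin.card_gam, TwistedTwin.piHom,
    TwistedTwin.piHom_apply, TwistedTwin.piHom_surjective,
    TwistedTwin.ker_le_C.antisymm (TwistedTwin.C_le_ker.trans TwistedTwin.ker_piHom.ge)⟩
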